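/- Let $f\in\mathbb{C}[z]$ be a monic polynomial of degree $N\ge 1$, let $\mathcal{K}$ be the convex hull of the set of its complex roots, and let $R$ be the radius of a closed disk in $\mathbb{C}$ containing $\mathcal{K}$. By a path of steepest descent for $|f|$ we mean a continuous, piecewise differentiable curve $\gamma\colon I\to\mathbb{C}$, defined on a non-empty interval $I$ of $\mathbb{R}$, along which $|f|$ is strictly decreasing and which is, up to the choice of parameter, an integral curve of $-\nabla|f|$: outside a set of break points with finitely many points in each compact subinterval of $I$, at each interior point $t$ of $I$ the derivative $\gamma'(t)$ exists and equals $-c(t)\,\nabla|f|(\gamma(t))$ for some real $c(t)>0$. The path links $\beta$ to $\alpha$ if $\gamma(t)$ tends to $\beta$ (resp. $\alpha$) as $t$ tends to the left (resp. right) end of $I$, this meaning that $\gamma$ takes that value at the end in question if the end belongs to $I$. **Theorem.** Any path of steepest descent for $|f|$ linking a point $\beta$ of $\mathcal{K}$ to a root $\alpha$ of $f$ is contained in $\mathcal{K}$, and its length is at most $\pi N R$. -/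

import Mathlib

open Filter Topology

/-- A path of steepest descent for `|f|`: a curve `γ` on a nonempty interval `I` of the real line
(of any kind: closed, half-open, open, bounded or not) which is continuous and piecewise
differentiable (differentiable at the interior points of `I` outside a set `S` of break points
having only finitely many points in each compact subinterval of `I`), which is an integral curve,
up to the choice of parameter, of the field `-∇|f|`, and along which `|f|` is decreasing.

The positive factor `c` expresses that the parameter is free: `c = 1` is the literal equation
`γ' = -∇|f|(γ)`. Strict decrease forces `f (γ t) ≠ 0` at every interior point `t` of `I`, so the
gradient below is always that of a function which is differentiable at `γ t`. -/
structure IsSteepestDescentPath (f : Polynomial ℂ) (I : Set ℝ) (γ : ℝ → ℂ) : Prop where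
  nonempty : I.Nonempty
  ordConnected : I.OrdConnected
  continuousOn : ContinuousOn γ I
  integralCurve : ∃ S : Set ℝ, (∀ a ∈ I, ∀ b ∈ I, (S ∩ Set.Icc a b).Finite) ∧
    ∀ t ∈ interior I, t ∉ S → ∃ c : ℝ, 0 < c ∧
      HasDerivAt γ (-(c • gradient (fun z : ℂ => ‖f.eval z‖) (γ t))) t
  strictAntiOn : StrictAntiOn (fun t => ‖f.eval (γ t)‖) I

/-- The curve `γ` on `I` links `β` to `α`: it starts at `β` and ends at `α`. If `I = [a, b]` this
says `γ a = β` and `γ b = α`; at an end that does not belong to `I` it is the limit of `γ`. -/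
def Links (I : Set ℝ) (γ : ℝ → ℂ) (β α : ℂ) : Prop :=
  Tendsto (fun t : I => γ t) atBot (𝓝 β) ∧ Tendsto (fun t : I => γ t) atTop (𝓝 α)

/-! The path stays in the convex hull `K` of the roots by the argument of the Gauss–Lucas theorem: at a
point `z` outside a half-plane that contains the roots `a`, the direction
`-∇|f| = -|f| ∑ (z - a) / |z - a|²` points towards this half-plane, so that a path which starts in it
cannot leave it (`IsSteepestDescentPath.image_subset_convexHull`).

The bound on the length comes from integral geometry. Along a path of steepest descent the argument
of `f` is constant, so that the path lies on an algebraic curve `Im (w f) = 0` of degree `N = deg f`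
(`IsSteepestDescentPath.im_conj_eval_mul_eval`), and it passes only once through each of its points,
since `|f|` is strictly decreasing. Hence, for all but countably many directions, a line in that
direction meets the path at most `N` times (`encard_fiber_re_mul_exp_le`). The projection of the path
orthogonal to such a direction takes each value at most `N` times and has values in an interval of
length `2R`, so its variation is at most `2RN` (`eVariationOn_le_of_encard_fiber_le`). Finally, the
length is at most half of the integral of these variations over the directions in `(0, π]`
(`two_mul_eVariationOn_le_lintegral`), that is, at most `πNR`. -/

/-! ### Variation of functions with finite fibres, and the Cauchy–Crofton inequality -/

open Set MeasureTheory in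
/-- An inequality of Banach indicatrix type: the variation is at most the integral over the values
`y` of the number of points above `y`. By the intermediate value theorem, a value
strictly between `g (u i)` and `g (u (i + 1))` is taken strictly between `u i` and `u (i + 1)`, so
that each value lies in at most `N` of the intervals which make up a partition sum. -/
theorem eVariationOn_le_of_encard_fiber_le {I : Set ℝ} (hI : I.OrdConnected) {g : ℝ → ℝ}
    (hg : ContinuousOn g I) {N : ℕ} (hN : ∀ y, {t ∈ I | g t = y}.encard ≤ N) {a b : ℝ}
    (hab : MapsTo g I (Icc a b)) :
    eVariationOn g I ≤ N * ENNReal.ofReal (b - a) := by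
  refine iSup_le fun ⟨n, u, hu, huI⟩ => ?_
  have key : ∀ y, ∑ i ∈ Finset.range n,
      (uIoo (g (u i)) (g (u (i + 1)))).indicator (fun _ => (1 : ENNReal)) y
        ≤ (Icc a b).indicator (fun _ => (N : ENNReal)) y := by
    intro y
    classical
    have hex : ∀ i, y ∈ uIoo (g (u i)) (g (u (i + 1))) →
        ∃ t ∈ Ioo (u i) (u (i + 1)), g t = y := by
      intro i hi
      have hle := hu (Nat.le_succ i)
      obtain ⟨t, ht, hty⟩ := intermediate_value_uIcc
        (hg.mono (hI.uIcc_subset (huI i) (huI (i + 1)))) (Ioo_subset_Icc_self hi)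
      rw [uIcc_of_le hle] at ht
      have h1 : y ≠ g (u i) := by
        rintro rfl; simp at hi
      have h2 : y ≠ g (u (i + 1)) := by
        rintro rfl; simp at hi
      refine ⟨t, ⟨lt_of_le_of_ne ht.1 ?_, lt_of_le_of_ne ht.2 ?_⟩, hty⟩
      · rintro rfl; exact h1 hty.symm
      · rintro rfl; exact h2 hty.symm
    by_cases hy : y ∈ Icc a b
    · rw [indicator_of_mem hy]
      simp only [indicator_apply, Finset.sum_boole]
      choose! t ht hty using hex
      set s := {i ∈ Finset.range n | y ∈ uIoo (g (u i)) (g (u (i + 1)))} with hs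
      have hmaps : MapsTo t s {t ∈ I | g t = y} := by
        intro i hi
        have hi' := (Finset.mem_filter.1 hi).2
        exact ⟨hI.out (huI i) (huI (i + 1)) (Ioo_subset_Icc_self (ht i hi')), hty i hi'⟩
      have hlt : ∀ i ∈ s, ∀ j ∈ s, i < j → t i < t j := by
        intro i hi j hj hij
        exact ((ht i (Finset.mem_filter.1 hi).2).2.trans_le (hu hij)).trans
          (ht j (Finset.mem_filter.1 hj).2).1
      have hinj : InjOn t s := by
        intro i hi j hj hij
        rcases lt_trichotomy i j with h | h | h
        · exact absurd hij (hlt i hi j hj h).ne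
        · exact h
        · exact absurd hij (hlt j hj i hi h).ne'
      have := (encard_le_encard_of_injOn hmaps hinj).trans (hN y)
      rw [encard_coe_eq_coe_finsetCard] at this
      exact_mod_cast this
    · rw [indicator_of_notMem hy]
      refine le_of_eq (Finset.sum_eq_zero fun i _ => indicator_of_notMem (fun hi => hy ?_) _)
      obtain ⟨t, ht, rfl⟩ := hex i hi
      exact hab (hI.out (huI i) (huI (i + 1)) (Ioo_subset_Icc_self ht))
  calc ∑ i ∈ Finset.range n, edist (g (u (i + 1))) (g (u i))
      = ∑ i ∈ Finset.range n, ∫⁻ y, (uIoo (g (u i)) (g (u (i + 1)))).indicator 1 y := by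
        refine Finset.sum_congr rfl fun i _ => ?_
        rw [lintegral_indicator_one (s := uIoo _ _) measurableSet_Ioo, Real.volume_uIoo,
          edist_dist, Real.dist_eq]
    _ = ∫⁻ y, ∑ i ∈ Finset.range n, (uIoo (g (u i)) (g (u (i + 1)))).indicator 1 y :=
        (lintegral_finsetSum _ fun i _ => measurable_one.indicator measurableSet_Ioo).symm
    _ ≤ ∫⁻ y, (Icc a b).indicator (fun _ => (N : ENNReal)) y := lintegral_mono key
    _ = N * ENNReal.ofReal (b - a) := by
        rw [lintegral_indicator_const measurableSet_Icc, Real.volume_Icc]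

theorem integral_abs_cos_sub (ψ : ℝ) : ∫ φ in (0 : ℝ)..Real.pi, |Real.cos (ψ - φ)| = 2 := by
  have hper : Function.Periodic (fun x => |Real.cos x|) Real.pi := fun x => by
    simp [Real.cos_add_pi]
  rw [intervalIntegral.integral_comp_sub_left (fun x => |Real.cos x|) ψ]
  have h := hper.intervalIntegral_add_eq (ψ - Real.pi) (-(Real.pi / 2))
  rw [sub_add_cancel, show -(Real.pi / 2) + Real.pi = Real.pi / 2 by ring] at h
  rw [sub_zero, h]
  have : ∫ x in (-(Real.pi / 2))..(Real.pi / 2), |Real.cos x|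
      = ∫ x in (-(Real.pi / 2))..(Real.pi / 2), Real.cos x := by
    refine intervalIntegral.integral_congr fun x hx => ?_
    rw [Set.uIcc_of_le (by linarith [Real.pi_pos])] at hx
    exact abs_of_nonneg (Real.cos_nonneg_of_mem_Icc hx)
  rw [this, integral_cos, Real.sin_neg, Real.sin_pi_div_two]
  norm_num

open Complex in
theorem re_mul_exp_neg_mul_I (w : ℂ) (φ : ℝ) :
    (w * exp (-(φ * I))).re = ‖w‖ * Real.cos (w.arg - φ) := by
  conv_lhs => rw [← norm_mul_exp_arg_mul_I w]
  rw [mul_assoc, ← exp_add, show (w.arg : ℂ) * I + -(φ * I) = ((w.arg - φ : ℝ) : ℂ) * I by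
    push_cast; ring, re_ofReal_mul, exp_ofReal_mul_I_re]

open MeasureTheory in
theorem lintegral_ofReal_abs_re_mul_exp (w : ℂ) :
    ∫⁻ φ in Set.Ioc 0 Real.pi, ENNReal.ofReal |(w * Complex.exp (-(φ * Complex.I))).re|
      = 2 * ENNReal.ofReal ‖w‖ := by
  simp only [re_mul_exp_neg_mul_I, abs_mul, abs_norm]
  rw [← ofReal_integral_eq_lintegral_ofReal, ← intervalIntegral.integral_of_le Real.pi_pos.le,
    intervalIntegral.integral_const_mul, integral_abs_cos_sub, ENNReal.ofReal_mul (norm_nonneg _),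
    mul_comm]
  · norm_num
  · exact (Continuous.integrableOn_Icc (by fun_prop)).mono_set Set.Ioc_subset_Icc_self
  · exact Eventually.of_forall fun φ => by positivity

open MeasureTheory in
/-- The Cauchy–Crofton inequality: twice the length of a plane curve is at most the integral over
the directions `φ ∈ (0, π]` of the variation of its orthogonal projections. No regularity of `γ` is needed, as
the mean value of the projected length is computed for each chord of a partition separately. -/
theorem two_mul_eVariationOn_le_lintegral (I : Set ℝ) (γ : ℝ → ℂ) :
    2 * eVariationOn γ I ≤ ∫⁻ φ in Set.Ioc 0 Real.pi,
      eVariationOn (fun t => (γ t * Complex.exp (-(φ * Complex.I))).re) I := by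
  rw [eVariationOn, ENNReal.mul_iSup]
  refine iSup_le fun ⟨n, u, hu, huI⟩ => ?_
  calc 2 * ∑ i ∈ Finset.range n, edist (γ (u (i + 1))) (γ (u i))
      = ∑ i ∈ Finset.range n, ∫⁻ φ in Set.Ioc 0 Real.pi, ENNReal.ofReal
          |((γ (u (i + 1)) - γ (u i)) * Complex.exp (-(φ * Complex.I))).re| := by
        simp only [lintegral_ofReal_abs_re_mul_exp, Finset.mul_sum, edist_dist, dist_eq_norm]
    _ = ∫⁻ φ in Set.Ioc 0 Real.pi, ∑ i ∈ Finset.range n, ENNReal.ofReal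
          |((γ (u (i + 1)) - γ (u i)) * Complex.exp (-(φ * Complex.I))).re| := by
        refine (lintegral_finsetSum _ fun i _ => Continuous.measurable ?_).symm
        exact ENNReal.continuous_ofReal.comp (by fun_prop)
    _ ≤ _ := by
        refine lintegral_mono fun φ => ?_
        refine le_of_eq_of_le ?_ (eVariationOn.sum_le (n := n) hu huI)
        refine Finset.sum_congr rfl fun i _ => ?_
        rw [edist_dist, Real.dist_eq, sub_mul, Complex.sub_re]

/-! ### Intersections of a line with the curve `Im (w f) = 0` -/

open Polynomial ComplexConjugate in
/-- A real line meets the real algebraic curve `Im q = 0` in at most `N` points, as soon as the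
coefficient of degree `N` of `Im q` on that line does not vanish. -/
theorem encard_setOf_im_eval_eq_zero_le {q : ℂ[X]} {N : ℕ} (hq : q.natDegree ≤ N)
    (hN : (q.coeff N).im ≠ 0) : {s : ℝ | (q.eval (s : ℂ)).im = 0}.encard ≤ N := by
  -- on the real axis, `q - q̄` is `2i` times the imaginary part of `q`
  set p : ℂ[X] := q - q.map (starRingEnd ℂ) with hp
  have hp0 : p ≠ 0 := fun h => hN <| by
    have := congrArg (fun r : ℂ[X] => r.coeff N) h
    simp only [hp, coeff_sub, coeff_map, coeff_zero, sub_eq_zero] at this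
    exact Complex.conj_eq_iff_im.1 this.symm
  have hdeg : p.natDegree ≤ N :=
    (natDegree_sub_le _ _).trans (max_le hq (natDegree_map_le.trans hq))
  have hmaps : Set.MapsTo (fun s : ℝ => (s : ℂ)) {s : ℝ | (q.eval (s : ℂ)).im = 0}
      (p.roots.toFinset : Set ℂ) := by
    intro s hs
    have h : (q.map (starRingEnd ℂ)).eval (s : ℂ) = conj (q.eval (s : ℂ)) := by
      conv_lhs => rw [← Complex.conj_ofReal s]
      rw [eval_map, eval₂_at_apply]
    rw [Finset.mem_coe, Multiset.mem_toFinset, mem_roots hp0, IsRoot, hp, eval_sub, h,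
      sub_eq_zero]
    exact (Complex.conj_eq_iff_im.2 hs).symm
  refine (Set.encard_le_encard_of_injOn hmaps Complex.ofReal_injective.injOn).trans ?_
  rw [Set.encard_coe_eq_coe_finsetCard]
  exact_mod_cast (Multiset.toFinset_card_le _).trans ((card_roots' _).trans hdeg)

open Polynomial in
/-- If `w f` is real along an injective curve, a line orthogonal to `exp (i φ)` meets the curve in at
most `deg f` points, unless `φ` is one of the directions in which the leading coefficient of
`Im (w f)` on the line vanishes. -/
theorem encard_fiber_re_mul_exp_le {f : ℂ[X]} (hf : f.Monic) {w : ℂ} {φ : ℝ}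
    (hφ : (w * (Complex.I * Complex.exp (φ * Complex.I)) ^ f.natDegree).im ≠ 0) {γ : ℝ → ℂ}
    {I : Set ℝ} (hinj : Set.InjOn γ I) (hγ : ∀ t ∈ I, (w * f.eval (γ t)).im = 0) (y : ℝ) :
    {t ∈ I | (γ t * Complex.exp (-(φ * Complex.I))).re = y}.encard ≤ f.natDegree := by
  set e : ℂ := Complex.exp (φ * Complex.I) with he
  have he0 : e * Complex.exp (-(φ * Complex.I)) = 1 := by rw [he, ← Complex.exp_add]; simp
  have hIe : Complex.I * e ≠ 0 := mul_ne_zero Complex.I_ne_zero (Complex.exp_ne_zero _)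
  -- parametrise the line by `s ↦ e (y + i s)`
  set l : ℂ[X] := C (Complex.I * e) * X + C (e * y) with hl
  have hl1 : l.natDegree = 1 := natDegree_linear hIe
  have hll : l.leadingCoeff = Complex.I * e := leadingCoeff_linear hIe
  have hcoeff : (C w * f.comp l).coeff f.natDegree = w * (Complex.I * e) ^ f.natDegree := by
    have := coeff_comp_degree_mul_degree (p := f) (q := l) (by simp [hl1])
    rw [hl1, mul_one, hf.leadingCoeff, one_mul, hll] at this
    rw [coeff_C_mul, this]
  have hdeg : (C w * f.comp l).natDegree ≤ f.natDegree :=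
    (natDegree_C_mul_le _ _).trans (by rw [natDegree_comp, hl1, mul_one])
  refine le_trans ?_ (encard_setOf_im_eval_eq_zero_le hdeg (by rwa [hcoeff]))
  have hpt : ∀ t, (γ t * Complex.exp (-(φ * Complex.I))).re = y →
      γ t = l.eval (((γ t * Complex.exp (-(φ * Complex.I))).im : ℝ) : ℂ) := by
    intro t ht
    have h1 := Complex.re_add_im (γ t * Complex.exp (-(φ * Complex.I)))
    rw [ht] at h1
    simp only [hl, eval_add, eval_mul, eval_C, eval_X]
    linear_combination (-e) * h1 - γ t * he0
  refine Set.encard_le_encard_of_injOn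
    (f := fun t => (γ t * Complex.exp (-(φ * Complex.I))).im) ?_ ?_
  · rintro t ⟨ht, hty⟩
    simp only [Set.mem_ofPred_eq, eval_mul, eval_C, eval_comp]
    rw [← hpt t hty]
    exact hγ t ht
  · rintro t ⟨ht, hty⟩ t' ⟨ht', hty'⟩ heq
    refine hinj ht ht' ?_
    rw [hpt t hty, hpt t' hty']
    exact congrArg (fun s : ℝ => l.eval (s : ℂ)) heq

theorem countable_setOf_im_mul_exp_pow_eq_zero {w : ℂ} (hw : w ≠ 0) {N : ℕ} (hN : N ≠ 0) :
    {φ : ℝ | (w * (Complex.I * Complex.exp (φ * Complex.I)) ^ N).im = 0}.Countable := by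
  set A : ℂ := w * Complex.I ^ N with hA
  have hA0 : A ≠ 0 := mul_ne_zero hw (pow_ne_zero _ Complex.I_ne_zero)
  refine (Set.countable_range fun k : ℤ => (k * Real.pi - A.arg) / N).mono fun φ hφ => ?_
  have h : w * (Complex.I * Complex.exp (φ * Complex.I)) ^ N
      = (‖A‖ : ℂ) * Complex.exp (((A.arg + N * φ : ℝ) : ℂ) * Complex.I) := by
    rw [mul_pow, ← mul_assoc, ← hA, ← Complex.exp_nat_mul]
    conv_lhs => rw [← Complex.norm_mul_exp_arg_mul_I A]
    rw [mul_assoc, ← Complex.exp_add]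
    push_cast
    ring_nf
  rw [Set.mem_ofPred_eq, h, Complex.im_ofReal_mul, Complex.exp_ofReal_mul_I_im] at hφ
  obtain ⟨k, hk⟩ := Real.sin_eq_zero_iff.1
    ((mul_eq_zero.1 hφ).resolve_left (norm_ne_zero_iff.2 hA0))
  refine ⟨k, ?_⟩
  have : (N : ℝ) ≠ 0 := by exact_mod_cast hN
  simp only
  rw [hk]
  field_simp
  ring

/-! ### The gradient of `|f|` -/

open Polynomial ComplexConjugate in
theorem hasGradientAt_norm_eval (f : ℂ[X]) {z : ℂ} (hz : f.eval z ≠ 0) :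
    HasGradientAt (fun z : ℂ => ‖f.eval z‖)
      (‖f.eval z‖ * conj (f.derivative.eval z / f.eval z)) z := by
  have h0 : ‖f.eval z‖ ≠ 0 := norm_ne_zero_iff.2 hz
  have h1 : HasFDerivAt (fun z : ℂ => f.eval z) _ z :=
    ((f.hasDerivAt z).hasFDerivAt).restrictScalars ℝ
  have h2 := h1.norm_sq.sqrt (by positivity)
  simp only [Real.sqrt_sq (norm_nonneg _)] at h2
  rw [hasGradientAt_iff_hasFDerivAt]
  refine h2.congr_fderiv (ContinuousLinearMap.ext fun v => ?_)
  have hc : (‖f.eval z‖ : ℂ) ≠ 0 := by exact_mod_cast h0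
  have key : conj ((‖f.eval z‖ : ℂ) * conj (f.derivative.eval z / f.eval z)) * v
      = ((‖f.eval z‖⁻¹ : ℝ) : ℂ) * (conj (f.eval z) * (v * f.derivative.eval z)) := by
    have hn : f.eval z * conj (f.eval z) = (‖f.eval z‖ : ℂ) ^ 2 := Complex.mul_conj' _
    simp only [map_mul, Complex.conj_ofReal, Complex.conj_conj, Complex.ofReal_inv]
    field_simp
    linear_combination (-f.derivative.eval z * v) * hn
  simp only [InnerProductSpace.toDual_apply_apply, Complex.inner]
  rw [mul_comm v, key, Complex.re_ofReal_mul]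
  simp [Complex.inner]
  field_simp

/-- A continuous function whose derivative is nonpositive outside a finite set decreases; nothing
is assumed about the derivative at the exceptional points. -/
theorem le_of_hasDerivAt_nonpos_off_finite {S : Set ℝ} (hS : S.Finite) {g : ℝ → ℝ} {a b : ℝ}
    (hab : a ≤ b) (hg : ContinuousOn g (Set.Icc a b))
    (hd : ∀ t ∈ Set.Ioo a b, t ∉ S → ∃ d ≤ 0, HasDerivAt g d t) : g b ≤ g a := by
  induction S, hS using Set.Finite.induction_on generalizing a b with
  | empty =>
    refine antitoneOn_of_deriv_nonpos (convex_Icc a b) hg ?_ ?_ (Set.left_mem_Icc.2 hab)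
      (Set.right_mem_Icc.2 hab) hab
    · intro t ht
      rw [interior_Icc] at ht
      obtain ⟨d, -, h⟩ := hd t ht (Set.notMem_empty _)
      exact h.differentiableAt.differentiableWithinAt
    · intro t ht
      rw [interior_Icc] at ht
      obtain ⟨d, hd0, h⟩ := hd t ht (Set.notMem_empty _)
      rwa [h.deriv]
  | @insert s S _ _ ih =>
    by_cases hs : s ∈ Set.Ioo a b
    · refine (ih hs.2.le (hg.mono (Set.Icc_subset_Icc_left hs.1.le)) fun t ht htS =>
        hd t ⟨hs.1.trans ht.1, ht.2⟩ ?_).trans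
        (ih hs.1.le (hg.mono (Set.Icc_subset_Icc_right hs.2.le)) fun t ht htS =>
          hd t ⟨ht.1, ht.2.trans hs.2⟩ ?_)
      · rintro (rfl | h)
        · exact lt_irrefl _ ht.1
        · exact htS h
      · rintro (rfl | h)
        · exact lt_irrefl _ ht.2
        · exact htS h
    · refine ih hab hg fun t ht htS => hd t ht ?_
      rintro (rfl | h)
      · exact hs ht
      · exact htS h

open Polynomial ComplexConjugate in
/-- The argument of the Gauss–Lucas theorem: if all the roots `a` of `f` lie in the half-plane
`ℓ ≤ ℓ z`, then `ℓ` is nonnegative at `∇|f| (z) = |f z| ∑ (z - a) / |z - a|²`. -/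
theorem apply_gradient_norm_eval_nonneg (f : ℂ[X]) (ℓ : ℂ →L[ℝ] ℝ) {z : ℂ}
    (hz : f.eval z ≠ 0) (hℓ : ∀ a, f.IsRoot a → ℓ a ≤ ℓ z) :
    0 ≤ ℓ (gradient (fun z : ℂ => ‖f.eval z‖) z) := by
  rw [(hasGradientAt_norm_eval f hz).gradient,
    (IsAlgClosed.splits f).eval_derivative_div_eval_of_ne_zero hz, ← Complex.real_smul, map_smul,
    map_multiset_sum, map_multiset_sum]
  refine mul_nonneg (norm_nonneg _) (Multiset.sum_nonneg fun x hx => ?_)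
  simp only [Multiset.map_map, Function.comp_apply, Multiset.mem_map] at hx
  obtain ⟨a, ha, rfl⟩ := hx
  have h : conj (1 / (z - a)) = (Complex.normSq (z - a))⁻¹ • (z - a) := by
    rw [one_div, Complex.inv_def, map_mul, Complex.conj_conj, Complex.conj_ofReal,
      Complex.real_smul, mul_comm]
  rw [h, map_smul, map_sub ℓ]
  exact mul_nonneg (inv_nonneg.2 (Complex.normSq_nonneg _))
    (sub_nonneg.2 (hℓ a (isRoot_of_mem_roots ha)))

open ComplexConjugate in
/-- Along an integral curve of `-∇|f|` the argument of `f` is stationary. The quotient of `f` by its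
conjugate determines the argument up to `π`, and is easier to differentiate. -/
theorem hasDerivAt_eval_div_conj {f : Polynomial ℂ} {γ : ℝ → ℂ} {t k : ℝ}
    (hft : f.eval (γ t) ≠ 0)
    (hder : HasDerivAt γ (-(k • gradient (fun z : ℂ => ‖f.eval z‖) (γ t))) t) :
    HasDerivAt (fun t => f.eval (γ t) / conj (f.eval (γ t))) 0 t := by
  have hc : conj (f.eval (γ t)) ≠ 0 := (map_ne_zero _).2 hft
  have h1 := (f.hasDerivAt (γ t)).comp t hder
  have h2 : HasDerivAt (fun t => conj (f.eval (γ t))) _ t := h1.star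
  refine (h1.div h2 hc).congr_deriv ?_
  rw [(hasGradientAt_norm_eval f hft).gradient, div_eq_zero_iff]
  left
  simp only [Function.comp_apply, Complex.real_smul, ← starRingEnd_apply, map_mul, map_neg,
    map_div₀, Complex.conj_ofReal, Complex.conj_conj]
  field_simp
  ring

/-! ### Paths of steepest descent -/

namespace IsSteepestDescentPath

variable {f : Polynomial ℂ} {I : Set ℝ} {γ : ℝ → ℂ}

theorem eval_ne_zero (h : IsSteepestDescentPath f I γ) {s t : ℝ} (hs : s ∈ I) (ht : t ∈ I)
    (hst : s < t) : f.eval (γ s) ≠ 0 :=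
  norm_pos_iff.1 ((norm_nonneg _).trans_lt (h.strictAntiOn hs ht hst))

/-- While the path is in a half-plane away from the roots, it moves towards its boundary line;
as it starts in the convex hull of the roots, it never leaves this hull. -/
theorem image_subset_convexHull (h : IsSteepestDescentPath f I γ) (hf : f ≠ 0) {β : ℂ}
    (hβ : β ∈ convexHull ℝ {z : ℂ | f.IsRoot z})
    (hlim : Tendsto (fun t : I => γ t) atBot (𝓝 β)) :
    γ '' I ⊆ convexHull ℝ {z : ℂ | f.IsRoot z} := by
  rintro _ ⟨b, hb, rfl⟩
  by_contra hbK
  have hfin : {z : ℂ | f.IsRoot z}.Finite := Polynomial.finite_setOfPred_isRoot hf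
  obtain ⟨ℓ, c, hK, hcb⟩ := geometric_hahn_banach_closed_point (convex_convexHull ℝ _)
    (hfin.isClosed_convexHull ℝ) hbK
  have : Nonempty I := ⟨⟨b, hb⟩⟩
  obtain ⟨⟨a, ha⟩, hac, hab⟩ := (((ℓ.continuous.tendsto β).comp hlim).eventually
    (gt_mem_nhds (hK β hβ))).and (eventually_le_atBot (⟨b, hb⟩ : I)) |>.exists
  simp only [Function.comp_apply] at hac
  replace hab : a ≤ b := hab
  have hsub : Set.Icc a b ⊆ I := h.ordConnected.out ha hb
  have hcont : ContinuousOn (fun t => ℓ (γ t)) (Set.Icc a b) :=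
    ℓ.continuous.comp_continuousOn (h.continuousOn.mono hsub)
  -- the last time in `[a, b]` spent in the half-plane
  have hcomp : IsCompact (Set.Icc a b ∩ (fun t => ℓ (γ t)) ⁻¹' Set.Iic c) :=
    isCompact_Icc.of_isClosed_subset (hcont.preimage_isClosed_of_isClosed isClosed_Icc isClosed_Iic)
      Set.inter_subset_left
  obtain ⟨r, ⟨hr, hrc⟩, hmax⟩ := hcomp.exists_isGreatest ⟨a, Set.left_mem_Icc.2 hab, hac.le⟩
  have hout : ∀ t ∈ Set.Ioo r b, c < ℓ (γ t) := fun t ht => not_le.1 fun hle =>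
    absurd (hmax ⟨⟨hr.1.trans ht.1.le, ht.2.le⟩, hle⟩) (not_le.2 ht.1)
  obtain ⟨S, hS, hd⟩ := h.integralCurve
  have hle := le_of_hasDerivAt_nonpos_off_finite (hS a ha b hb) hr.2
    (hcont.mono (Set.Icc_subset_Icc_left hr.1)) fun t ht htS => by
      have htab : t ∈ Set.Ioo a b := ⟨hr.1.trans_lt ht.1, ht.2⟩
      obtain ⟨k, hk, hder⟩ := hd t
        (interior_mono hsub (by rwa [interior_Icc]))
        fun hS' => htS ⟨hS', Set.Ioo_subset_Icc_self htab⟩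
      refine ⟨_, ?_, ℓ.hasFDerivAt.comp_hasDerivAt t hder⟩
      rw [map_neg, map_smul, neg_nonpos]
      refine mul_nonneg hk.le (apply_gradient_norm_eval_nonneg f ℓ
        (h.eval_ne_zero (hsub (Set.Ioo_subset_Icc_self htab)) hb ht.2) fun z hz => ?_)
      exact ((hK z (subset_convexHull ℝ _ hz)).trans (hout t ht)).le
  exact absurd (hle.trans hrc) (not_le.2 hcb)

open ComplexConjugate in
/-- A path of steepest descent is mapped by `f` into a real line through the origin. -/
theorem im_conj_eval_mul_eval (h : IsSteepestDescentPath f I γ) {s t : ℝ} (hs : s ∈ I)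
    (ht : t ∈ I) : (conj (f.eval (γ s)) * f.eval (γ t)).im = 0 := by
  wlog hst : s ≤ t generalizing s t
  · have := this ht hs (le_of_not_ge hst)
    rw [← Complex.conj_eq_iff_im] at this ⊢
    rw [map_mul, Complex.conj_conj, mul_comm] at this ⊢
    exact this.symm
  by_cases hft : f.eval (γ t) = 0
  · simp [hft]
  have hsub : Set.Icc s t ⊆ I := h.ordConnected.out hs ht
  have hne : ∀ r ∈ Set.Icc s t, f.eval (γ r) ≠ 0 := fun r hr => by
    rcases hr.2.eq_or_lt with rfl | hrt
    · exact hft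
    · exact h.eval_ne_zero (hsub hr) ht hrt
  obtain ⟨S, hS, hd⟩ := h.integralCurve
  have hF : ContinuousOn (fun r => f.eval (γ r)) (Set.Icc s t) :=
    f.continuous.comp_continuousOn (h.continuousOn.mono hsub)
  have hcont : ContinuousOn (fun r => f.eval (γ r) / conj (f.eval (γ r))) (Set.Icc s t) :=
    hF.div (Complex.continuous_conj.comp_continuousOn hF) fun r hr => (map_ne_zero _).2 (hne r hr)
  -- the quotient `f / conj f` is the same at both ends
  have hint := MeasureTheory.integral_eq_of_hasDerivAt_off_countable_of_le
    (fun r => f.eval (γ r) / conj (f.eval (γ r))) (fun _ => 0) hst (hS s hs t ht).countable hcont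
    (fun r hr => by
      obtain ⟨k, -, hder⟩ := hd r (interior_mono hsub (by rw [interior_Icc]; exact hr.1))
        fun hS' => hr.2 ⟨hS', Set.Ioo_subset_Icc_self hr.1⟩
      exact hasDerivAt_eval_div_conj (hne r (Set.Ioo_subset_Icc_self hr.1)) hder)
    (by simp)
  rw [intervalIntegral.integral_zero, eq_comm, sub_eq_zero, div_eq_div_iff
    ((map_ne_zero _).2 hft) ((map_ne_zero _).2 (hne s (Set.left_mem_Icc.2 hst)))] at hint
  rw [← Complex.conj_eq_iff_im, map_mul, Complex.conj_conj]
  linear_combination -hint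

open ComplexConjugate MeasureTheory in
/-- Almost every line meets the path in at most `deg f` points, and the projections of the path have
values in an interval of length `2 * R`; the Cauchy–Crofton inequality gives `π * deg f * R`. -/
theorem eVariationOn_le (h : IsSteepestDescentPath f I γ) (hf : f.Monic) (hN : f.natDegree ≠ 0)
    {x₀ : ℂ} {R : ℝ} (hR : Set.MapsTo γ I (Metric.closedBall x₀ R)) :
    eVariationOn γ I ≤ ENNReal.ofReal (Real.pi * f.natDegree * R) := by
  rcases I.subsingleton_or_nontrivial with hI | hI
  · simp [eVariationOn.subsingleton γ hI]
  obtain ⟨s, hs, t, ht, hst⟩ := hI.exists_lt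
  set w := conj (f.eval (γ s)) with hw
  have hw0 : w ≠ 0 := (map_ne_zero _).2 (h.eval_ne_zero hs ht hst)
  have hinj : Set.InjOn γ I := fun a ha b hb hab => h.strictAntiOn.injOn ha hb (by simp [hab])
  have hbound : ∀ φ : ℝ, (w * (Complex.I * Complex.exp (φ * Complex.I)) ^ f.natDegree).im ≠ 0 →
      eVariationOn (fun t => (γ t * Complex.exp (-(φ * Complex.I))).re) I
        ≤ f.natDegree * ENNReal.ofReal (2 * R) := by
    intro φ hφ
    have hab : Set.MapsTo (fun t => (γ t * Complex.exp (-(φ * Complex.I))).re) I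
        (Set.Icc ((x₀ * Complex.exp (-(φ * Complex.I))).re - R)
          ((x₀ * Complex.exp (-(φ * Complex.I))).re + R)) := by
      intro r hr
      have h1 : |((γ r - x₀) * Complex.exp (-(φ * Complex.I))).re| ≤ R := by
        refine (Complex.abs_re_le_norm _).trans ?_
        have : ‖Complex.exp (-(φ * Complex.I))‖ = 1 := by
          rw [← neg_mul, ← Complex.ofReal_neg, Complex.norm_exp_ofReal_mul_I]
        rw [norm_mul, this, mul_one, ← dist_eq_norm]
        exact hR hr
      rw [sub_mul, Complex.sub_re, abs_le] at h1
      constructor <;> dsimp only <;> linarith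
    refine (eVariationOn_le_of_encard_fiber_le h.ordConnected ?_
      (encard_fiber_re_mul_exp_le hf hφ hinj fun r hr => h.im_conj_eval_mul_eval hs hr)
      hab).trans (le_of_eq ?_)
    · exact Complex.continuous_re.comp_continuousOn (h.continuousOn.mul continuousOn_const)
    · ring_nf
  have hR0 : 0 ≤ R := dist_nonneg.trans (hR hs)
  have hae : ∀ᵐ φ : ℝ ∂(volume.restrict (Set.Ioc 0 Real.pi)),
      (w * (Complex.I * Complex.exp (φ * Complex.I)) ^ f.natDegree).im ≠ 0 :=
    ae_restrict_of_ae ((countable_setOf_im_mul_exp_pow_eq_zero hw0 hN).ae_notMem volume)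
  have key : 2 * eVariationOn γ I ≤ 2 * ENNReal.ofReal (Real.pi * f.natDegree * R) := by
    calc 2 * eVariationOn γ I
        ≤ _ := two_mul_eVariationOn_le_lintegral I γ
      _ ≤ ∫⁻ _ in Set.Ioc 0 Real.pi, f.natDegree * ENNReal.ofReal (2 * R) :=
          lintegral_mono_ae (hae.mono hbound)
      _ = 2 * ENNReal.ofReal (Real.pi * f.natDegree * R) := by
          rw [setLIntegral_const, Real.volume_Ioc, sub_zero, ← ENNReal.ofReal_natCast,
            ← ENNReal.ofReal_ofNat 2, ← ENNReal.ofReal_mul (by positivity),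
            ← ENNReal.ofReal_mul (by positivity), ← ENNReal.ofReal_mul (by positivity)]
          ring_nf
  exact (ENNReal.mul_le_mul_iff_right two_ne_zero ENNReal.ofNat_ne_top).1 key

end IsSteepestDescentPath

theorem theorem1p1 (f : Polynomial ℂ) (hf : f.Monic)
    (x₀ : ℂ) (R : ℝ) (hR : convexHull ℝ {z : ℂ | f.IsRoot z} ⊆ Metric.closedBall x₀ R)
    (α β : ℂ) (hα : f.IsRoot α) (hβ : β ∈ convexHull ℝ {z : ℂ | f.IsRoot z})
    (I : Set ℝ) (γ : ℝ → ℂ) (hγ : IsSteepestDescentPath f I γ) (hlink : Links I γ β α) :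
    γ '' I ⊆ convexHull ℝ {z : ℂ | f.IsRoot z} ∧
      eVariationOn γ I ≤ ENNReal.ofReal (Real.pi * (f.natDegree : ℝ) * R) := by
  have hK := hγ.image_subset_convexHull hf.ne_zero hβ hlink.1
  have hN : f.natDegree ≠ 0 := fun h0 => by
    rw [hf.natDegree_eq_zero.1 h0] at hα
    simp at hα
  exact ⟨hK, hγ.eVariationOn_le hf hN (Set.mapsTo_iff_image_subset.2 (hK.trans hR))⟩
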